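/- Let $n\ge 1$, write points of $\mathbb R^n=\mathbb R^{n-1}\times\mathbb R$ as $(x,y)$, and let $\Pi(x,y)=x$. Let $m\ge 1$ and let $S\subset\mathbb R^n$ be a smooth embedded $m$-dimensional submanifold, possibly with boundary. For $x\in\mathbb R^{n-1}$ and $y\in\mathbb R$ let $S_x=\{y\in\mathbb R:(x,y)\in S\}$ and $S^y=\{x\in\mathbb R^{n-1}:(x,y)\in S\}$ be the vertical and horizontal slices of $S$. Let $\mathcal H^d$ denote $d$-dimensional Hausdorff measure, normalized to agree with Lebesgue measure on $\mathbb R^d$. All integrals and sums below are of nonnegative functions and take values in $[0,\infty]$. (1) For all smooth nonnegative functions $f:\mathbb R^{n-1}\to\mathbb R$ and $g:\mathbb R\to\mathbb R$, $$\int_{(x,y)\in S} f(x)g(y)\,d\mathcal H^m(x,y)\le \int_{x\in\Pi(S)}\Bigl(\sum_{y\in S_x}g(y)\Bigr)f(x)\,d\mathcal H^m(x)+\int_{y\in\mathbb R}\Bigl(\int_{x\in S^y}f(x)\,d\mathcal H^{m-1}(x)\Bigr)g(y)\,dy.$$ (2) For $d\ge 0$ let $\Phi_d(z)=(4\pi)^{-d/2}e^{-|z|^2/4}$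 for $z$ in any Euclidean space, and for a set $T$ in a Euclidean space let $\Phi_d[T]=\int_T\Phi_d\,d\mathcal H^d$. Let $\Phi_m[\Pi|S]=\int_{x\in\Pi(S)}\#(S_x)\,\Phi_m(x)\,d\mathcal H^m(x)$ be the $\Phi_m$-area of $\Pi(S)$ counted with multiplicity. Then $$\Phi_m[S]\le\Phi_m[\Pi|S]+\int_{y\in\mathbb R}\Phi_{m-1}[S^y]\,\Phi_1(y)\,dy.$$ -/

import Mathlib

open MeasureTheory Set
open scoped ENNReal ContDiff

namespace GaussSlicing

/-- The model `m`-dimensional half-space in `ℝⁿ`: the last `n - m` coordinates vanish and the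
coordinate number `0` is nonnegative. -/
def modelHalfSpace (n m : ℕ) : Set (EuclideanSpace ℝ (Fin n)) :=
  {z | (∀ i : Fin n, m ≤ (i : ℕ) → z i = 0) ∧ ∀ i : Fin n, (i : ℕ) = 0 → 0 ≤ z i}

/-- `S` is a smooth (embedded) `m`-dimensional submanifold of `ℝⁿ`, possibly with boundary: near
each of its points, a smooth diffeomorphism `φ` between open subsets of `ℝⁿ` takes `S` to the
model half-space. Around interior points `φ` takes values in the part where the coordinate
number `0` is positive, so that submanifolds without boundary are included. -/
def IsSubmanifold {n : ℕ} (m : ℕ) (S : Set (EuclideanSpace ℝ (Fin n))) : Prop :=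
  ∀ p ∈ S, m ≤ n ∧
    ∃ φ : OpenPartialHomeomorph (EuclideanSpace ℝ (Fin n)) (EuclideanSpace ℝ (Fin n)),
      p ∈ φ.source ∧ ContDiffOn ℝ ∞ φ φ.source ∧ ContDiffOn ℝ ∞ φ.symm φ.target ∧
      φ.IsImage S (modelHalfSpace n m)

/-- The point `(x, y) ∈ ℝᵏ × ℝ = ℝᵏ⁺¹`. -/
noncomputable def pair {k : ℕ} (x : EuclideanSpace ℝ (Fin k)) (y : ℝ) :
    EuclideanSpace ℝ (Fin (k + 1)) :=
  WithLp.toLp 2 (Fin.snoc (α := fun _ => ℝ) (fun i => x i) y)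

/-- The vertical projection `Π (x, y) = x`. -/
noncomputable def proj {k : ℕ} (p : EuclideanSpace ℝ (Fin (k + 1))) : EuclideanSpace ℝ (Fin k) :=
  WithLp.toLp 2 (fun i => p i.castSucc)

/-- The height `(x, y) ↦ y`. -/
def height {k : ℕ} (p : EuclideanSpace ℝ (Fin (k + 1))) : ℝ := p (Fin.last k)

/-- The vertical slice `S_x = {y | (x, y) ∈ S}`. -/
def vertSlice {k : ℕ} (S : Set (EuclideanSpace ℝ (Fin (k + 1)))) (x : EuclideanSpace ℝ (Fin k)) :
    Set ℝ :=
  {y | pair x y ∈ S}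

/-- The horizontal slice `S^y = {x | (x, y) ∈ S}`. -/
def horSlice {k : ℕ} (S : Set (EuclideanSpace ℝ (Fin (k + 1)))) (y : ℝ) :
    Set (EuclideanSpace ℝ (Fin k)) :=
  {x | pair x y ∈ S}

/-- The Gaussian weight `Φ_m(x) = (4π)^{-m/2} exp (-|x|² / 4)`, on any Euclidean space. -/
noncomputable def gaussWeight {E : Type*} [Norm E] (m : ℕ) (x : E) : ℝ :=
  (4 * Real.pi) ^ (-(m : ℝ) / 2) * Real.exp (-‖x‖ ^ 2 / 4)

/-- The `Φ`-area `Φ_m[S] = ∫_S Φ_m dH^m`, with `H^m` the `m`-dimensional Hausdorff measure in the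
usual normalization (it is Lebesgue measure on `ℝᵐ`). -/
noncomputable def gaussArea {n : ℕ} (m : ℕ) (S : Set (EuclideanSpace ℝ (Fin n))) : ℝ≥0∞ :=
  ∫⁻ p in S, ENNReal.ofReal (gaussWeight m p) ∂μHE[m]

/-- The `Φ`-area `Φ_m[Π|S]` of the projection `Π(S)`, counted with multiplicity: the multiplicity
at `x` is the number of points of `S` above `x`. -/
noncomputable def gaussAreaProj {k : ℕ} (m : ℕ) (S : Set (EuclideanSpace ℝ (Fin (k + 1)))) :
    ℝ≥0∞ :=
  ∫⁻ x in proj '' S, ((vertSlice S x).encard : ℝ≥0∞) * ENNReal.ofReal (gaussWeight m x) ∂μHE[m]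

end GaussSlicing

/-!
The tangent space `T` of `S` at a point makes some angle with the vertical direction. If
`c ∈ [0, 1]` is the norm of the orthogonal projection of the vertical unit vector to `T`, then `T` has
orthonormal coordinates in which the height is `c` times the last coordinate, and in which the
projection `Π` is, up to an isometry, the dilation of the last coordinate by `J = √(1 - c²)`. So
`Π` multiplies areas in `T` by `J`, while by Cavalieri's principle the integral over `y` of the
areas of the horizontal slices is `c` times the area. As `J + c ≥ 1`, the inequality holds for
subsets of `T`.

No Jacobians of nonlinear maps are needed to pass from `T` to `S`. All secants of a small piece
`B` of `S` are almost parallel to `T` (`IsSubmanifold.exists_isOpen_flat`). If `c ≠ 0`, there is a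
linear retraction `Q` to `T` that preserves the height (`exists_adapted_coordinates`), and on `B`
it is almost isometric; as it preserves the height, it maps slices to slices. If `J ≠ 0`, the
projection `Π` on `B` is comparable with `Π ∘ Q` by maps with Lipschitz constants close to `1`.
Since Hausdorff measures scale in a controlled way under Lipschitz maps, `B` satisfies the
inequality up to a factor close to `1` (`exists_pos_slicing_of_flat`). When `c = 0` or `J = 0`,
one of the two terms on the right suffices.

The right-hand side is a functional of the weight (`sliceIntegral`). Its integrals are lower
integrals, so it is countably superadditive without any measurability of fiber sums or slice
areas; hence the inequality passes from the pieces of a countable partition to Borel subsets of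
`S`, and then from indicators to measurable weights
(`IsSubmanifold.lintegral_le_mul_sliceIntegral`). The Gaussian statement is the case `f = Φ_m`,
`g y = exp (-y² / 4)`.
-/

namespace GaussSlicing

/-! ### Coordinates -/

section Coordinates

variable {k : ℕ}

@[simp]
theorem proj_pair (x : EuclideanSpace ℝ (Fin k)) (y : ℝ) : proj (pair x y) = x := by
  ext i; simp [proj, pair]

@[simp]
theorem height_pair (x : EuclideanSpace ℝ (Fin k)) (y : ℝ) : height (pair x y) = y := by
  simp [height, pair]

@[simp]
theorem pair_proj_height (p : EuclideanSpace ℝ (Fin (k + 1))) : pair (proj p) (height p) = p := by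
  ext i
  refine Fin.lastCases ?_ (fun i => ?_) i <;> simp [proj, pair, height]

theorem height_sub (p q : EuclideanSpace ℝ (Fin (k + 1))) :
    height (p - q) = height p - height q := rfl

theorem height_smul (c : ℝ) (p : EuclideanSpace ℝ (Fin (k + 1))) :
    height (c • p) = c * height p := rfl

theorem height_add (p q : EuclideanSpace ℝ (Fin (k + 1))) :
    height (p + q) = height p + height q := rfl

theorem proj_sub (p q : EuclideanSpace ℝ (Fin (k + 1))) : proj (p - q) = proj p - proj q := rfl

theorem norm_sq_eq_proj_height (p : EuclideanSpace ℝ (Fin (k + 1))) :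
    ‖p‖ ^ 2 = ‖proj p‖ ^ 2 + height p ^ 2 := by
  simp [EuclideanSpace.norm_sq_eq, Fin.sum_univ_castSucc, proj, height]

theorem norm_proj_le (p : EuclideanSpace ℝ (Fin (k + 1))) : ‖proj p‖ ≤ ‖p‖ :=
  le_of_sq_le_sq (by nlinarith [norm_sq_eq_proj_height p, sq_nonneg (height p)]) (norm_nonneg _)

@[fun_prop]
theorem continuous_proj : Continuous (proj (k := k)) := by
  unfold proj; fun_prop

@[fun_prop]
theorem continuous_height : Continuous (height (k := k)) := by
  unfold height; fun_prop

@[fun_prop]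
theorem continuous_pair :
    Continuous (fun z : EuclideanSpace ℝ (Fin k) × ℝ => pair z.1 z.2) := by
  unfold pair
  refine (PiLp.continuous_toLp 2 _).comp (continuous_pi fun i => ?_)
  refine Fin.lastCases ?_ (fun i => ?_) i
  · simpa using continuous_snd
  · simp only [Fin.snoc_castSucc]; fun_prop

theorem measurableSet_horSlice {A : Set (EuclideanSpace ℝ (Fin (k + 1)))} (hA : MeasurableSet A)
    (y : ℝ) : MeasurableSet (horSlice A y) :=
  (continuous_pair.comp (by fun_prop : Continuous fun x => (x, y))).measurable hA

/-- Cavalieri's principle for horizontal slices. -/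
theorem volume_eq_lintegral_horSlice {A : Set (EuclideanSpace ℝ (Fin (k + 1)))}
    (hA : MeasurableSet A) : volume A = ∫⁻ y : ℝ, volume (horSlice A y) := by
  have h1 := (PiLp.volume_preserving_toLp (Fin k)).prod (MeasurePreserving.id (volume : Measure ℝ))
  have h2 := (volume_preserving_piFinSuccAbove (fun _ : Fin (k + 1) => ℝ) (Fin.last k))
  have h3 := PiLp.volume_preserving_ofLp (Fin (k + 1))
  have h4 := (h1.comp Measure.measurePreserving_swap).comp (h2.comp h3)
  have h5 : ∀ p : EuclideanSpace ℝ (Fin (k + 1)),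
    ((Prod.map (WithLp.toLp 2) id ∘ Prod.swap) ∘
      (MeasurableEquiv.piFinSuccAbove (fun _ : Fin (k + 1) => ℝ) (Fin.last k)) ∘
        (WithLp.ofLp)) p = (proj p, height p) := by
    intro p
    ext i <;> simp [proj, height, MeasurableEquiv.piFinSuccAbove, Fin.init]
  have h6 : MeasurePreserving (fun p : EuclideanSpace ℝ (Fin (k + 1)) => (proj p, height p))
      volume (volume.prod volume) := (funext h5) ▸ h4
  have hm : MeasurableSet ((fun z : EuclideanSpace ℝ (Fin k) × ℝ => pair z.1 z.2) ⁻¹' A) :=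
    continuous_pair.measurable hA
  have := h6.measure_preimage hm.nullMeasurableSet
  rw [Measure.prod_apply_symm hm] at this
  rw [show (fun p : EuclideanSpace ℝ (Fin (k + 1)) => (proj p, height p)) ⁻¹'
    ((fun z : EuclideanSpace ℝ (Fin k) × ℝ => pair z.1 z.2) ⁻¹' A) = A by ext p; simp] at this
  exact this

/-- Integrating the slices over a dilated height variable multiplies by the dilation factor. -/
theorem lintegral_div_eq (F : ℝ → ℝ≥0∞) {c : ℝ} (hc : 0 < c) :
    ∫⁻ y : ℝ, F (y / c) = ENNReal.ofReal c * ∫⁻ y : ℝ, F y := by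
  have h := (MeasurableEquiv.mulLeft₀ c⁻¹ (inv_ne_zero hc.ne')).measurableEmbedding.lintegral_map
    (μ := (volume : Measure ℝ)) F
  have h2 : Measure.map (MeasurableEquiv.mulLeft₀ c⁻¹ (inv_ne_zero hc.ne')) (volume : Measure ℝ)
      = ENNReal.ofReal c • volume := by
    have := Real.map_volume_mul_left (inv_ne_zero hc.ne')
    rw [inv_inv, abs_of_pos hc] at this
    exact this
  rw [h2, lintegral_smul_measure] at h
  rw [← smul_eq_mul, h]
  exact lintegral_congr fun y => by simp [div_eq_inv_mul]

end Coordinates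

/-! ### Hausdorff measure and Lipschitz maps -/

/-- If distances between values of `h` are at most `K` times the distances between the values
of `f`, then `h '' s` is the image of `f '' s` under a `K`-Lipschitz map. -/
theorem euclideanHausdorffMeasure_image_le_of_dist_le {X Y Z : Type*}
    [MetricSpace Y] [MeasurableSpace Y] [BorelSpace Y]
    [MetricSpace Z] [MeasurableSpace Z] [BorelSpace Z] {f : X → Y} {h : X → Z} {s : Set X}
    {K : NNReal} (d : ℕ)
    (H : ∀ p ∈ s, ∀ q ∈ s, dist (h p) (h q) ≤ K * dist (f p) (f q)) :
    μHE[d] (h '' s) ≤ (K : ℝ≥0∞) ^ d * μHE[d] (f '' s) := by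
  rcases s.eq_empty_or_nonempty with rfl | ⟨p₀, hp₀⟩
  · simp
  have : Nonempty X := ⟨p₀⟩
  have hinv : ∀ p ∈ s, Function.invFunOn f s (f p) ∈ s ∧ f (Function.invFunOn f s (f p)) = f p :=
    fun p hp => ⟨Function.invFunOn_mem ⟨p, hp, rfl⟩, Function.invFunOn_eq ⟨p, hp, rfl⟩⟩
  have hL : LipschitzOnWith K (h ∘ Function.invFunOn f s) (f '' s) := by
    refine LipschitzOnWith.of_dist_le_mul ?_
    rintro _ ⟨p, hp, rfl⟩ _ ⟨q, hq, rfl⟩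
    simpa [(hinv p hp).2, (hinv q hq).2] using H _ (hinv p hp).1 _ (hinv q hq).1
  have himg : (h ∘ Function.invFunOn f s) '' (f '' s) = h '' s := by
    rw [← image_comp]
    refine image_congr fun p hp => ?_
    have := H _ (hinv p hp).1 p hp
    rw [(hinv p hp).2, dist_self, mul_zero] at this
    exact dist_le_zero.1 this
  rw [← himg, Measure.euclideanHausdorffMeasure_def, Measure.euclideanHausdorffMeasure_def]
  have := hL.hausdorffMeasure_image_le (d := d) (by positivity)
  rw [ENNReal.rpow_natCast] at this
  simp only [Measure.smul_apply, ENNReal.smul_def, smul_eq_mul]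
  calc _ ≤ _ := mul_le_mul_right this _
    _ = _ := by ring

/-! ### The slice functional -/

/-- The right-hand side of the slicing inequality for a weight `u` on `ℝᵏ⁺¹`: the integral over
`x ∈ ℝᵏ` of the sums of `u` over vertical lines, plus the integral over the heights `y ∈ ℝ` of the
`(m - 1)`-dimensional integrals of `u` over horizontal hyperplanes. No measurability of `u` is
assumed, so these are lower integrals, which are superadditive. -/
noncomputable def sliceIntegral {k : ℕ} (m : ℕ) (u : EuclideanSpace ℝ (Fin (k + 1)) → ℝ≥0∞) :
    ℝ≥0∞ :=
  (∫⁻ x, ∑' y : ℝ, u (pair x y) ∂(μHE[m] : Measure (EuclideanSpace ℝ (Fin k)))) +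
    ∫⁻ y : ℝ, ∫⁻ x, u (pair x y) ∂(μHE[m - 1] : Measure (EuclideanSpace ℝ (Fin k)))

/-- The dilation of the last coordinate by the factor `J`. -/
noncomputable def scaleHeight {j : ℕ} (J : ℝ) (w : EuclideanSpace ℝ (Fin (j + 1))) :
    EuclideanSpace ℝ (Fin (j + 1)) :=
  pair (proj w) (J * height w)

@[simp]
theorem proj_scaleHeight {j : ℕ} (J : ℝ) (w : EuclideanSpace ℝ (Fin (j + 1))) :
    proj (scaleHeight J w) = proj w := by simp [scaleHeight]

@[simp]
theorem height_scaleHeight {j : ℕ} (J : ℝ) (w : EuclideanSpace ℝ (Fin (j + 1))) :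
    height (scaleHeight J w) = J * height w := by simp [scaleHeight]

theorem continuous_scaleHeight {j : ℕ} (J : ℝ) : Continuous (scaleHeight (j := j) J) :=
  continuous_pair.comp (by fun_prop : Continuous fun w => (proj w, J * height w))

theorem scaleHeight_inv_scaleHeight {j : ℕ} {J : ℝ} (hJ : J ≠ 0)
    (w : EuclideanSpace ℝ (Fin (j + 1))) : scaleHeight J⁻¹ (scaleHeight J w) = w := by
  rw [scaleHeight, proj_scaleHeight, height_scaleHeight, inv_mul_cancel_left₀ hJ, pair_proj_height]

theorem volume_scaleHeight_image {j : ℕ} {J : ℝ} (hJ : 0 < J)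
    {A : Set (EuclideanSpace ℝ (Fin (j + 1)))} (hA : MeasurableSet A) :
    volume (scaleHeight J '' A) = ENNReal.ofReal J * volume A := by
  have himg : scaleHeight J '' A = scaleHeight J⁻¹ ⁻¹' A := by
    refine congrFun (image_eq_preimage_of_inverse (scaleHeight_inv_scaleHeight hJ.ne')
      fun w => ?_) A
    simpa using scaleHeight_inv_scaleHeight (inv_ne_zero hJ.ne') w
  rw [himg, volume_eq_lintegral_horSlice ((continuous_scaleHeight _).measurable hA),
    volume_eq_lintegral_horSlice hA, ← lintegral_div_eq _ hJ]
  refine lintegral_congr fun y => congrArg volume ?_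
  ext x
  simp [horSlice, scaleHeight, div_eq_inv_mul]

/-! ### Almost flat pieces -/

/-- The slicing inequality for a set `B` with a chart `Q` into `ℝʲ⁺¹` that is almost isometric,
in which the height is `c` times the last coordinate (unless `c = 0`) and `proj` on `B` looks almost
like the dilation of the last coordinate by `J` (unless `J = 0`). The volume of `Q '' B`
is at most `J` times itself, which the projection controls, plus `c` times itself, which the slices
control by Cavalieri's principle. When `J` or `c` is zero, the corresponding
term is not needed. -/
theorem euclideanHausdorffMeasure_le_sliceIntegral {k j : ℕ}
    {B : Set (EuclideanSpace ℝ (Fin (k + 1)))} (hB : MeasurableSet B) {c J : ℝ} (hc0 : 0 ≤ c)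
    (hJ0 : 0 ≤ J) (hcJ : 1 ≤ J + c)
    {Q : EuclideanSpace ℝ (Fin (k + 1)) → EuclideanSpace ℝ (Fin (j + 1))} (hQ : Continuous Q)
    {K : NNReal} (hK : 1 ≤ K)
    (hdist : ∀ p ∈ B, ∀ q ∈ B, dist p q ≤ K * dist (Q p) (Q q))
    (hheight : c ≠ 0 → ∀ p, height p = c * height (Q p))
    (hproj : J ≠ 0 → ∀ p ∈ B, ∀ q ∈ B,
      dist (scaleHeight J (Q p)) (scaleHeight J (Q q)) ≤ K * dist (proj p) (proj q))
    (hslice : ∀ p ∈ B, ∀ q ∈ B, height p = height q → dist (Q p) (Q q) ≤ K * dist p q) :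
    μHE[j + 1] B ≤ (K : ℝ≥0∞) ^ (2 * (j + 1)) * sliceIntegral (j + 1) (B.indicator 1) := by
  have hQinj : InjOn Q B := fun p hp q hq h => by
    have := hdist p hp q hq
    rw [h, dist_self, mul_zero] at this
    exact dist_le_zero.1 this
  have hA : MeasurableSet (Q '' B) := hB.image_of_continuousOn_injOn hQ.continuousOn hQinj
  have hK' : (1 : ℝ≥0∞) ≤ K := by exact_mod_cast hK
  have hvol : μHE[j + 1] B ≤ (K : ℝ≥0∞) ^ (j + 1) * volume (Q '' B) := by
    have := euclideanHausdorffMeasure_image_le_of_dist_le (f := Q) (h := id) (j + 1) hdist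
    rwa [image_id, EuclideanSpace.euclideanHausdorffMeasure_eq_volume] at this
  have harea : ENNReal.ofReal J * volume (Q '' B) ≤ (K : ℝ≥0∞) ^ (j + 1) *
      ∫⁻ x, ∑' y : ℝ, B.indicator (1 : EuclideanSpace ℝ (Fin (k + 1)) → ℝ≥0∞) (pair x y)
        ∂μHE[j + 1] := by
    rcases hJ0.eq_or_lt with rfl | hJ
    · simp
    have hinj : InjOn proj B := fun p hp q hq h => by
      have := hproj hJ.ne' p hp q hq
      rw [h, dist_self, mul_zero] at this
      have := congrArg (scaleHeight J⁻¹) (dist_le_zero.1 this)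
      rw [scaleHeight_inv_scaleHeight hJ.ne', scaleHeight_inv_scaleHeight hJ.ne'] at this
      exact hQinj hp hq this
    -- Measurability of the projection matters: a lower integral would only see its inner measure.
    have hPB : MeasurableSet (proj '' B) :=
      hB.image_of_continuousOn_injOn continuous_proj.continuousOn hinj
    rw [← volume_scaleHeight_image hJ hA, ← image_comp]
    have h1 := euclideanHausdorffMeasure_image_le_of_dist_le (f := proj) (h := scaleHeight J ∘ Q)
      (j + 1) (hproj hJ.ne')
    rw [EuclideanSpace.euclideanHausdorffMeasure_eq_volume] at h1
    refine h1.trans ?_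
    gcongr
    rw [← lintegral_indicator_one hPB]
    refine lintegral_mono (indicator_le fun x hx => ?_)
    obtain ⟨p, hp, rfl⟩ := hx
    refine le_trans ?_ (ENNReal.le_tsum (height p))
    simp [hp]
  have hcoarea : ENNReal.ofReal c * volume (Q '' B) ≤ (K : ℝ≥0∞) ^ (j + 1) *
      ∫⁻ y : ℝ, ∫⁻ x, B.indicator (1 : EuclideanSpace ℝ (Fin (k + 1)) → ℝ≥0∞) (pair x y)
        ∂μHE[j] := by
    rcases hc0.eq_or_lt with rfl | hc
    · simp
    rw [volume_eq_lintegral_horSlice hA, ← lintegral_div_eq _ hc,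
      ← lintegral_const_mul' _ _ (by simp)]
    refine lintegral_mono fun y => ?_
    have hind : ∫⁻ x, B.indicator (1 : EuclideanSpace ℝ (Fin (k + 1)) → ℝ≥0∞) (pair x y) ∂μHE[j] =
        μHE[j] (horSlice B y) := by
      rw [← lintegral_indicator_one (measurableSet_horSlice hB y)]
      rfl
    have hsub : horSlice (Q '' B) (y / c) ⊆ (fun x => proj (Q (pair x y))) '' horSlice B y := by
      rintro x ⟨p, hp, hpx⟩
      have hy : height p = y := by
        rw [hheight hc.ne' p, hpx, height_pair, mul_div_cancel₀ _ hc.ne']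
      refine ⟨proj p, ?_, ?_⟩
      · rw [← hy]; simpa [horSlice] using hp
      · simp [← hy, hpx]
    have h1 := euclideanHausdorffMeasure_image_le_of_dist_le (f := id)
      (h := fun x => proj (Q (pair x y))) (s := horSlice B y) (K := K) j (fun x hx x' hx' => by
        have h2 := hslice _ hx _ hx' (by simp)
        have h3 : dist (pair x y) (pair x' y) = dist x x' := by
          rw [dist_eq_norm, dist_eq_norm,
            ← sq_eq_sq₀ (norm_nonneg _) (norm_nonneg _), norm_sq_eq_proj_height]
          simp [height_sub, proj_sub]
        rw [h3] at h2
        refine le_trans ?_ h2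
        rw [dist_eq_norm, dist_eq_norm, ← proj_sub]
        exact norm_proj_le _)
    rw [image_id, EuclideanSpace.euclideanHausdorffMeasure_eq_volume] at h1
    rw [hind]
    refine ((measure_mono hsub).trans h1).trans ?_
    gcongr
    exact Nat.le_succ j
  calc μHE[j + 1] B ≤ (K : ℝ≥0∞) ^ (j + 1) * volume (Q '' B) := hvol
    _ ≤ (K : ℝ≥0∞) ^ (j + 1) * (ENNReal.ofReal J * volume (Q '' B) +
          ENNReal.ofReal c * volume (Q '' B)) := by
        gcongr
        rw [← add_mul, ← ENNReal.ofReal_add hJ0 hc0]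
        exact le_mul_of_one_le_left' (by simpa using hcJ)
    _ ≤ (K : ℝ≥0∞) ^ (j + 1) * ((K : ℝ≥0∞) ^ (j + 1) * _ + (K : ℝ≥0∞) ^ (j + 1) * _) := by
        gcongr
    _ = _ := by
        rw [sliceIntegral, Nat.add_sub_cancel]; ring

theorem exists_orthonormalBasis_last_smul {T : Type*} [NormedAddCommGroup T]
    [InnerProductSpace ℝ T] {j : ℕ} (hT : Module.finrank ℝ T = j + 1) (u : T) :
    ∃ b : OrthonormalBasis (Fin (j + 1)) ℝ T, u = ‖u‖ • b (Fin.last j) := by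
  have : FiniteDimensional ℝ T := FiniteDimensional.of_finrank_eq_succ hT
  by_cases hu : u = 0
  · exact ⟨(stdOrthonormalBasis ℝ T).reindex (finCongr hT), by simp [hu]⟩
  · have hv : Orthonormal ℝ (({Fin.last j} : Set (Fin (j + 1))).domRestrict
        fun _ => ‖u‖⁻¹ • u) := by
      refine ⟨fun i => ?_, fun a b hab => absurd (Subsingleton.elim a b) hab⟩
      simp [domRestrict, norm_smul, hu]
    obtain ⟨b, hb⟩ := hv.exists_orthonormalBasis_extension_of_card_eq (by simpa using hT)
    refine ⟨b, ?_⟩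
    rw [hb _ rfl, smul_smul, mul_inv_cancel₀ (by simpa using hu), one_smul]

/-- A `(j + 1)`-dimensional subspace `T` of `ℝᵏ⁺¹` has isometric coordinates `ι` in which the
height is `c` times the last coordinate, and if `T` is not horizontal, there is a linear retraction
onto `T` that preserves the height. -/
theorem exists_adapted_coordinates {k j : ℕ} (T : Submodule ℝ (EuclideanSpace ℝ (Fin (k + 1))))
    (hT : Module.finrank ℝ T = j + 1) :
    ∃ c : ℝ, 0 ≤ c ∧ c ≤ 1 ∧
      ∃ ι : EuclideanSpace ℝ (Fin (j + 1)) →ₗᵢ[ℝ] EuclideanSpace ℝ (Fin (k + 1)),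
      ∃ Q : EuclideanSpace ℝ (Fin (k + 1)) →L[ℝ] EuclideanSpace ℝ (Fin (j + 1)),
        (∀ v ∈ T, ∃ w, ι w = v) ∧ (∀ w, Q (ι w) = w) ∧ (∀ w, height (ι w) = c * height w) ∧
        (c ≠ 0 → ∀ v, height v = c * height (Q v)) := by
  let e : EuclideanSpace ℝ (Fin (k + 1)) := EuclideanSpace.single (Fin.last k) 1
  have he : ∀ v, height v = inner ℝ e v := fun v => by
    simp [e, height, EuclideanSpace.inner_single_left]
  let u : T := T.orthogonalProjectionOnto e
  obtain ⟨b, hb⟩ := exists_orthonormalBasis_last_smul hT u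
  let ι : EuclideanSpace ℝ (Fin (j + 1)) →ₗᵢ[ℝ] EuclideanSpace ℝ (Fin (k + 1)) :=
    T.subtypeₗᵢ.comp b.repr.symm.toLinearIsometry
  have hι : ∀ w, height (ι w) = ‖u‖ * height w := fun w => by
    have h1 : inner ℝ e (ι w) = inner ℝ u (b.repr.symm w) := by
      simp [u, ι]
    rw [he, h1, hb, norm_smul, norm_norm, b.norm_eq_one, mul_one, real_inner_smul_left,
      ← b.repr_apply_apply, LinearIsometryEquiv.apply_symm_apply]
    rfl
  let P : EuclideanSpace ℝ (Fin (k + 1)) →L[ℝ] EuclideanSpace ℝ (Fin (j + 1)) :=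
    (b.repr : T →L[ℝ] EuclideanSpace ℝ (Fin (j + 1))).comp T.orthogonalProjectionOnto
  have hP : ∀ w, P (ι w) = w := fun w => by
    simp [P, ι]
  let h : EuclideanSpace ℝ (Fin (k + 1)) →L[ℝ] ℝ := innerSL ℝ e
  let a : EuclideanSpace ℝ (Fin (j + 1)) := EuclideanSpace.single (Fin.last j) 1
  -- The correction term vanishes on `T`; if `T` is horizontal, division by zero makes it zero.
  let Q : EuclideanSpace ℝ (Fin (k + 1)) →L[ℝ] EuclideanSpace ℝ (Fin (j + 1)) :=
    P + ((‖u‖⁻¹ • (h - h.comp (ι.toContinuousLinearMap.comp P))).smulRight a)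
  have hQ : ∀ v, Q v = P v + (‖u‖⁻¹ * (height v - height (ι (P v)))) • a := fun v => by
    simp [Q, h, he]
  refine ⟨‖u‖, norm_nonneg _, ?_, ι, Q, ?_, ?_, hι, ?_⟩
  · calc ‖u‖ ≤ ‖e‖ := T.norm_orthogonalProjectionOnto_apply_le e
      _ = 1 := by simp [e]
  · intro v hv
    exact ⟨b.repr ⟨v, hv⟩, by simp [ι]⟩
  · intro w
    rw [hQ, hP]
    simp
  · intro hc v
    have ha : height a = 1 := by simp [a, height]
    rw [hQ, hι, height_add, height_smul, ha]
    field_simp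
    ring

/-- Pieces that are almost flat, in the sense that all secants are close to one fixed
`(j + 1)`-dimensional subspace, satisfy the slicing inequality up to a factor close to `1`. -/
theorem exists_pos_slicing_of_flat {k j : ℕ} {c : ℝ} (hc0 : 0 ≤ c) (hc1 : c ≤ 1)
    (ι : EuclideanSpace ℝ (Fin (j + 1)) →ₗᵢ[ℝ] EuclideanSpace ℝ (Fin (k + 1)))
    (Q : EuclideanSpace ℝ (Fin (k + 1)) →L[ℝ] EuclideanSpace ℝ (Fin (j + 1)))
    (hι : ∀ w, height (ι w) = c * height w)
    (hQ : c ≠ 0 → ∀ v, height v = c * height (Q v)) {K : NNReal} (hK : 1 < K) :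
    ∃ ε : ℝ, 0 < ε ∧ ∀ B : Set (EuclideanSpace ℝ (Fin (k + 1))), MeasurableSet B →
      (∀ p ∈ B, ∀ q ∈ B, ‖p - q - ι (Q (p - q))‖ ≤ ε * ‖p - q‖) →
      μHE[j + 1] B ≤ (K : ℝ≥0∞) ^ (2 * (j + 1)) * sliceIntegral (j + 1) (B.indicator 1) := by
  -- `ι` followed by `proj` multiplies the last coordinate by `√(1 - c ^ 2)`, up to an isometry.
  set J := √(1 - c ^ 2) with hJdef
  have hJ2 : J ^ 2 = 1 - c ^ 2 := Real.sq_sqrt (by nlinarith)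
  have hJ0 : 0 ≤ J := Real.sqrt_nonneg _
  have hcJ : 1 ≤ J + c := by nlinarith [mul_nonneg hJ0 hc0]
  have hJ1 : J ≤ 1 := by nlinarith
  have hnorm : ∀ w, ‖proj (ι w)‖ = ‖scaleHeight J w‖ := fun w => by
    rw [← sq_eq_sq₀ (norm_nonneg _) (norm_nonneg _)]
    have h1 := norm_sq_eq_proj_height (ι w)
    have h2 := norm_sq_eq_proj_height w
    rw [ι.norm_map, hι] at h1
    rw [norm_sq_eq_proj_height (scaleHeight J w), proj_scaleHeight, height_scaleHeight, mul_pow,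
      hJ2]
    linarith
  have hscale : ∀ w : EuclideanSpace ℝ (Fin (j + 1)), J * ‖w‖ ≤ ‖scaleHeight J w‖ := fun w => by
    refine le_of_sq_le_sq ?_ (norm_nonneg _)
    rw [mul_pow, norm_sq_eq_proj_height (scaleHeight J w), norm_sq_eq_proj_height w,
      proj_scaleHeight, height_scaleHeight]
    have h : 0 ≤ 1 - J ^ 2 := by rw [hJ2]; nlinarith
    nlinarith [mul_nonneg (sq_nonneg ‖proj w‖) h]
  have hscale_sub : ∀ v w : EuclideanSpace ℝ (Fin (j + 1)),
      dist (scaleHeight J v) (scaleHeight J w) = ‖scaleHeight J (v - w)‖ := fun v w => by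
    rw [dist_eq_norm, ← sq_eq_sq₀ (norm_nonneg _) (norm_nonneg _), norm_sq_eq_proj_height,
      norm_sq_eq_proj_height (scaleHeight J (v - w))]
    simp only [proj_sub, height_sub, proj_scaleHeight, height_scaleHeight, mul_sub]
  have hK' : (1 : ℝ) < K := by exact_mod_cast hK
  obtain ⟨η, hη0, hη1, hηK⟩ : ∃ η : ℝ, 0 < η ∧ η ≤ 1 ∧ 1 + η ≤ K :=
    ⟨min 1 (K - 1), by simp [hK'], min_le_left _ _, by linarith [min_le_right (1 : ℝ) (K - 1)]⟩
  -- `ε` is small compared with `J`, the contraction factor of `proj`, unless `J = 0`, when the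
  -- projection is not used.
  obtain ⟨ε, hε0, hεη, hεJ⟩ : ∃ ε : ℝ, 0 < ε ∧ ε ≤ η / 8 ∧ (J ≠ 0 → ε ≤ J * (η / 8)) := by
    rcases hJ0.eq_or_lt with h | h
    · exact ⟨η / 8, by positivity, le_rfl, fun h' => absurd h.symm h'⟩
    · exact ⟨J * (η / 8), by positivity, by nlinarith, fun _ => le_rfl⟩
  refine ⟨ε, hε0, fun B hB hflat => ?_⟩
  have hle : ∀ v : EuclideanSpace ℝ (Fin (k + 1)), ‖v - ι (Q v)‖ ≤ ε * ‖v‖ →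
      (1 - ε) * ‖v‖ ≤ ‖Q v‖ ∧ ‖Q v‖ ≤ (1 + ε) * ‖v‖ := fun v hv => by
    have h1 := norm_sub_norm_le v (ι (Q v))
    have h2 := norm_sub_norm_le (ι (Q v)) v
    rw [norm_sub_rev] at h2
    rw [ι.norm_map] at h1 h2
    constructor <;> linarith
  refine euclideanHausdorffMeasure_le_sliceIntegral hB hc0 hJ0 hcJ Q.continuous hK.le ?_ hQ ?_ ?_
  · intro p hp q hq
    rw [dist_eq_norm, dist_eq_norm, ← map_sub]
    have h := (hle _ (hflat p hp q hq)).1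
    calc ‖p - q‖ ≤ (1 + η) * ((1 - ε) * ‖p - q‖) := by
          rw [← mul_assoc]
          exact le_mul_of_one_le_left (norm_nonneg _) (by nlinarith)
      _ ≤ (1 + η) * ‖Q (p - q)‖ := by gcongr
      _ ≤ K * ‖Q (p - q)‖ := by gcongr
  · intro hJ p hp q hq
    rw [hscale_sub, dist_eq_norm, ← map_sub, ← proj_sub]
    set v := p - q
    have hv := hflat p hp q hq
    have h := (hle _ hv).1
    have h1 : ‖scaleHeight J (Q v)‖ ≤ ‖proj v‖ + ε * ‖v‖ := by
      rw [← hnorm]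
      have h2 := norm_sub_norm_le (proj (ι (Q v))) (proj v)
      rw [← proj_sub] at h2
      have h3 := norm_proj_le (ι (Q v) - v)
      rw [norm_sub_rev] at h3
      linarith
    have h4 : ε * ‖v‖ ≤ (η / 4) * ‖scaleHeight J (Q v)‖ := by
      have h5 : ε * ‖v‖ ≤ J * (η / 8) * ‖v‖ := by gcongr; exact hεJ hJ
      have h6 : ‖v‖ ≤ 2 * ‖Q v‖ := by nlinarith [norm_nonneg v]
      calc ε * ‖v‖ ≤ J * (η / 8) * ‖v‖ := h5
        _ ≤ J * (η / 8) * (2 * ‖Q v‖) := by gcongr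
        _ = (η / 4) * (J * ‖Q v‖) := by ring
        _ ≤ _ := by gcongr; exact hscale _
    have h7 : (1 - η / 4) * ‖scaleHeight J (Q v)‖ ≤ ‖proj v‖ := by linarith
    calc ‖scaleHeight J (Q v)‖ ≤ (1 + η) * ((1 - η / 4) * ‖scaleHeight J (Q v)‖) := by
          rw [← mul_assoc]
          exact le_mul_of_one_le_left (norm_nonneg _) (by nlinarith)
      _ ≤ (1 + η) * ‖proj v‖ := by gcongr
      _ ≤ K * ‖proj v‖ := by gcongr
  · intro p hp q hq _
    rw [dist_eq_norm, dist_eq_norm, ← map_sub]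
    refine (hle _ (hflat p hp q hq)).2.trans ?_
    gcongr
    linarith

/-! ### Submanifolds are locally almost flat -/

/-- The linear map `ℝᵐ → ℝⁿ` that appends zeros (or drops coordinates, if `n < m`). -/
noncomputable def zeroPad (m n : ℕ) : EuclideanSpace ℝ (Fin m) →ₗ[ℝ] EuclideanSpace ℝ (Fin n) where
  toFun w := WithLp.toLp 2 fun i => if h : (i : ℕ) < m then w ⟨i, h⟩ else 0
  map_add' v w := by ext i; by_cases h : (i : ℕ) < m <;> simp [h]
  map_smul' c w := by ext i; by_cases h : (i : ℕ) < m <;> simp [h]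

theorem zeroPad_injective {m n : ℕ} (hmn : m ≤ n) : Function.Injective (zeroPad m n) := by
  intro v w h
  ext i
  have := congrArg (fun z : EuclideanSpace ℝ (Fin n) => z (Fin.castLE hmn i)) h
  simpa [zeroPad] using this

theorem exists_zeroPad_eq_of_mem_modelHalfSpace_sub {m n : ℕ} (hmn : m ≤ n)
    {z z' : EuclideanSpace ℝ (Fin n)} (hz : z ∈ modelHalfSpace n m)
    (hz' : z' ∈ modelHalfSpace n m) : ∃ w, zeroPad m n w = z - z' := by
  refine ⟨WithLp.toLp 2 fun i => (z - z') (Fin.castLE hmn i), ?_⟩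
  ext i
  by_cases h : (i : ℕ) < m
  · simp [zeroPad, h]
  · simp [zeroPad, h, hz.1 i (not_lt.1 h), hz'.1 i (not_lt.1 h)]

theorem isClosed_modelHalfSpace (n m : ℕ) : IsClosed (modelHalfSpace n m) := by
  have : modelHalfSpace n m = (⋂ (i : Fin n) (_ : m ≤ (i : ℕ)), {z | z i = 0}) ∩
      ⋂ (i : Fin n) (_ : (i : ℕ) = 0), {z | 0 ≤ z i} := by
    ext z; simp [modelHalfSpace]
  rw [this]
  refine IsClosed.inter (isClosed_iInter fun i => isClosed_iInter fun _ => ?_)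
    (isClosed_iInter fun i => isClosed_iInter fun _ => ?_)
  · exact isClosed_eq (by fun_prop) continuous_const
  · exact isClosed_le continuous_const (by fun_prop)

/-- Near each of its points, all secants of a submanifold are close to the tangent space, and the
submanifold is a Borel set. This is strict differentiability of the inverse chart `φ.symm`, combined
with a Lipschitz bound for the chart `φ`. -/
theorem IsSubmanifold.exists_isOpen_flat {n m : ℕ} {S : Set (EuclideanSpace ℝ (Fin n))}
    (hS : IsSubmanifold m S) {p : EuclideanSpace ℝ (Fin n)} (hp : p ∈ S) :
    ∃ T : Submodule ℝ (EuclideanSpace ℝ (Fin n)), Module.finrank ℝ T = m ∧ ∀ δ : ℝ, 0 < δ →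
      ∃ U : Set (EuclideanSpace ℝ (Fin n)), IsOpen U ∧ p ∈ U ∧ MeasurableSet (S ∩ U) ∧
        ∀ q ∈ S ∩ U, ∀ q' ∈ S ∩ U, ∃ v ∈ T, ‖q - q' - v‖ ≤ δ * ‖q - q'‖ := by
  obtain ⟨hmn, φ, hpφ, hφ, hφs, himg⟩ := hS p hp
  have hφp : φ p ∈ φ.target := φ.map_source hpφ
  have h1 : HasStrictFDerivAt φ (fderiv ℝ φ p) p :=
    (hφ.contDiffAt (φ.open_source.mem_nhds hpφ)).hasStrictFDerivAt (by simp)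
  have h2 : HasStrictFDerivAt φ.symm (fderiv ℝ φ.symm (φ p)) (φ p) :=
    (hφs.contDiffAt (φ.open_target.mem_nhds hφp)).hasStrictFDerivAt (by simp)
  set L := fderiv ℝ φ.symm (φ p)
  have hLinj : Function.Injective L := by
    have h3 : HasFDerivAt (φ ∘ φ.symm) ((fderiv ℝ φ p).comp L) (φ p) := by
      refine HasFDerivAt.comp _ ?_ h2.hasFDerivAt
      rw [φ.left_inv hpφ]
      exact h1.hasFDerivAt
    have h4 : HasFDerivAt (φ ∘ φ.symm) (ContinuousLinearMap.id ℝ _) (φ p) := by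
      refine (hasFDerivAt_id (φ p)).congr_of_eventuallyEq ?_
      filter_upwards [φ.open_target.mem_nhds hφp] with z hz
      exact φ.right_inv hz
    have h5 := h3.unique h4
    refine Function.LeftInverse.injective (g := fderiv ℝ φ p) fun z => ?_
    exact congrArg (fun A : EuclideanSpace ℝ (Fin n) →L[ℝ] EuclideanSpace ℝ (Fin n) => A z) h5
  refine ⟨((L : EuclideanSpace ℝ (Fin n) →ₗ[ℝ] EuclideanSpace ℝ (Fin n)) ∘ₗ zeroPad m n).range,
    ?_, fun δ hδ => ?_⟩
  · have hinj : Function.Injective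
        ((L : EuclideanSpace ℝ (Fin n) →ₗ[ℝ] EuclideanSpace ℝ (Fin n)) ∘ₗ zeroPad m n) := by
      rw [LinearMap.coe_comp]
      exact hLinj.comp (zeroPad_injective hmn)
    rw [LinearMap.finrank_range_of_inj hinj, finrank_euclideanSpace,
      Fintype.card_fin]
  obtain ⟨C, V, hV, hC⟩ := h1.exists_lipschitzOnWith
  have hCpos : 0 < (C : ℝ) + 1 := by positivity
  have h6 := h2.isLittleO.def (div_pos hδ hCpos)
  have h7 := φ.continuousAt hpφ
  rw [nhds_prod_eq] at h6
  obtain ⟨W, hW, h8⟩ := Filter.eventually_prod_self_iff'.1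
    ((h7.tendsto.prodMap h7.tendsto).eventually h6)
  obtain ⟨U, hUsub, hU, hpU⟩ := mem_nhds_iff.1
    (Filter.inter_mem (Filter.inter_mem hV hW) (φ.open_source.mem_nhds hpφ))
  refine ⟨U, hU, hpU, ?_, ?_⟩
  · have h9 : S ∩ U = U \ (φ.source ∩ φ ⁻¹' (modelHalfSpace n m)ᶜ) := by
      ext q
      constructor
      · rintro ⟨hqS, hqU⟩
        exact ⟨hqU, fun h => h.2 ((himg h.1).2 hqS)⟩
      · rintro ⟨hqU, h⟩
        have hqs := (hUsub hqU).2
        exact ⟨(himg hqs).1 (by_contra fun h' => h ⟨hqs, h'⟩), hqU⟩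
    rw [h9]
    exact hU.measurableSet.diff (φ.continuousOn.isOpen_inter_preimage φ.open_source
      (isClosed_modelHalfSpace n m).isOpen_compl).measurableSet
  · rintro q ⟨hqS, hqU⟩ q' ⟨hqS', hqU'⟩
    obtain ⟨⟨hqV, hqW⟩, hqs⟩ := hUsub hqU
    obtain ⟨⟨hqV', hqW'⟩, hqs'⟩ := hUsub hqU'
    obtain ⟨w, hw⟩ := exists_zeroPad_eq_of_mem_modelHalfSpace_sub hmn ((himg hqs).2 hqS)
      ((himg hqs').2 hqS')
    refine ⟨L (φ q - φ q'), ⟨w, by simp [hw]⟩, ?_⟩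
    have h10 := h8 q hqW q' hqW'
    simp only [Prod.map, φ.left_inv hqs, φ.left_inv hqs'] at h10
    have h11 := hC.dist_le_mul q hqV q' hqV'
    rw [dist_eq_norm, dist_eq_norm] at h11
    calc _ ≤ δ / (C + 1) * ‖φ q - φ q'‖ := h10
      _ ≤ δ / (C + 1) * ((C + 1) * ‖q - q'‖) := by
          gcongr
          exact h11.trans (by gcongr; linarith)
      _ = δ * ‖q - q'‖ := by field_simp

/-- Borel pieces of a submanifold near a given point satisfy the slicing inequality up to a factor
`K ^ (2 * m)` with `K` as close to `1` as desired. -/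
theorem IsSubmanifold.exists_isOpen_slicing {k j : ℕ} {S : Set (EuclideanSpace ℝ (Fin (k + 1)))}
    (hS : IsSubmanifold (j + 1) S) {K : NNReal} (hK : 1 < K) {p : EuclideanSpace ℝ (Fin (k + 1))}
    (hp : p ∈ S) :
    ∃ U : Set (EuclideanSpace ℝ (Fin (k + 1))), IsOpen U ∧ p ∈ U ∧ MeasurableSet (S ∩ U) ∧
      ∀ B ⊆ S ∩ U, MeasurableSet B →
        μHE[j + 1] B ≤ (K : ℝ≥0∞) ^ (2 * (j + 1)) * sliceIntegral (j + 1) (B.indicator 1) := by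
  obtain ⟨T, hT, hflat⟩ := hS.exists_isOpen_flat hp
  obtain ⟨c, hc0, hc1, ι, Q, hTι, hQι, hι, hQ⟩ := exists_adapted_coordinates T hT
  obtain ⟨ε, hε, hmain⟩ := exists_pos_slicing_of_flat hc0 hc1 ι Q hι hQ hK
  obtain ⟨U, hU, hpU, hSU, hsec⟩ := hflat (ε / (1 + ‖Q‖)) (by positivity)
  refine ⟨U, hU, hpU, hSU, fun B hBU hB => hmain B hB fun q hq q' hq' => ?_⟩
  obtain ⟨v, hv, hle⟩ := hsec q (hBU hq) q' (hBU hq')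
  obtain ⟨w, rfl⟩ := hTι v hv
  set x := q - q'
  have hx : x - ι (Q x) = (x - ι w) - ι (Q (x - ι w)) := by
    rw [map_sub Q x (ι w), map_sub ι (Q x), hQι]; abel
  calc ‖x - ι (Q x)‖ ≤ ‖x - ι w‖ + ‖Q (x - ι w)‖ := by
        rw [hx, ← ι.norm_map (Q (x - ι w))]
        exact norm_sub_le _ _
    _ ≤ ‖x - ι w‖ + ‖Q‖ * ‖x - ι w‖ := by gcongr; exact Q.le_opNorm _
    _ = (1 + ‖Q‖) * ‖x - ι w‖ := by ring
    _ ≤ (1 + ‖Q‖) * (ε / (1 + ‖Q‖) * ‖x‖) := by gcongr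
    _ = ε * ‖x‖ := by field_simp

/-! ### From pieces to the whole submanifold -/

/-- Lower integrals are countably superadditive. -/
theorem tsum_lintegral_le {α : Type*} [MeasurableSpace α] (μ : Measure α)
    (f : ℕ → α → ℝ≥0∞) : ∑' n, ∫⁻ a, f n a ∂μ ≤ ∫⁻ a, ∑' n, f n a ∂μ := by
  rw [ENNReal.tsum_eq_iSup_sum]
  refine iSup_le fun s => le_trans ?_
    (lintegral_mono (f := fun a => ∑ n ∈ s, f n a) fun a => ENNReal.sum_le_tsum s)
  induction s using Finset.cons_induction with
  | empty => simp
  | cons n s hn ih =>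
    simp only [Finset.sum_cons]
    exact (add_le_add le_rfl ih).trans (le_lintegral_add _ _)

section SliceIntegral

variable {k m : ℕ}

theorem sliceIntegral_mono {u v : EuclideanSpace ℝ (Fin (k + 1)) → ℝ≥0∞} (h : u ≤ v) :
    sliceIntegral m u ≤ sliceIntegral m v :=
  add_le_add (lintegral_mono fun _ => ENNReal.tsum_le_tsum fun _ => h _)
    (lintegral_mono fun _ => lintegral_mono fun _ => h _)

theorem sliceIntegral_add_le (u v : EuclideanSpace ℝ (Fin (k + 1)) → ℝ≥0∞) :
    sliceIntegral m u + sliceIntegral m v ≤ sliceIntegral m (u + v) := by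
  rw [sliceIntegral, sliceIntegral, add_add_add_comm]
  refine add_le_add ?_ ?_
  · refine (le_lintegral_add _ _).trans (lintegral_mono fun x => ?_)
    simp only [Pi.add_apply, ENNReal.tsum_add, le_refl]
  · exact (le_lintegral_add _ _).trans (lintegral_mono fun y => le_lintegral_add _ _)

theorem tsum_sliceIntegral_le (u : ℕ → EuclideanSpace ℝ (Fin (k + 1)) → ℝ≥0∞) :
    ∑' n, sliceIntegral m (u n) ≤ sliceIntegral m (fun p => ∑' n, u n p) := by
  simp only [sliceIntegral, ENNReal.tsum_add]
  refine add_le_add ?_ ?_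
  · refine (tsum_lintegral_le _ _).trans (lintegral_mono fun x => ?_)
    rw [ENNReal.tsum_comm]
  · exact (tsum_lintegral_le _ _).trans (lintegral_mono fun y => tsum_lintegral_le _ _)

theorem mul_sliceIntegral_le (c : ℝ≥0∞) (u : EuclideanSpace ℝ (Fin (k + 1)) → ℝ≥0∞) :
    c * sliceIntegral m u ≤ sliceIntegral m (fun p => c * u p) := by
  rw [sliceIntegral, mul_add]
  refine add_le_add ?_ ?_
  · refine (lintegral_const_mul_le _ _).trans (lintegral_mono fun x => ?_)
    rw [ENNReal.tsum_mul_left]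
  · exact (lintegral_const_mul_le _ _).trans (lintegral_mono fun y => lintegral_const_mul_le _ _)

end SliceIntegral

/-- The local inequalities add up over a countable partition of `S`, since the slice functional is
superadditive. -/
theorem IsSubmanifold.euclideanHausdorffMeasure_inter_le {k j : ℕ}
    {S : Set (EuclideanSpace ℝ (Fin (k + 1)))} (hS : IsSubmanifold (j + 1) S) {K : NNReal}
    (hK : 1 < K) {B : Set (EuclideanSpace ℝ (Fin (k + 1)))} (hB : MeasurableSet B) :
    μHE[j + 1] (B ∩ S) ≤
      (K : ℝ≥0∞) ^ (2 * (j + 1)) * sliceIntegral (j + 1) ((B ∩ S).indicator 1) := by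
  choose! U hU hpU hSU hle using fun p (hp : p ∈ S) => hS.exists_isOpen_slicing hK hp
  obtain ⟨t, htS, htc, hcover⟩ := TopologicalSpace.countable_cover_nhdsWithin
    fun p hp => mem_nhdsWithin_of_mem_nhds ((hU p hp).mem_nhds (hpU p hp))
  rcases t.eq_empty_or_nonempty with rfl | htne
  · have : S = ∅ := by simpa using hcover
    simp [this]
  obtain ⟨a, rfl⟩ := htc.exists_eq_range htne
  let V : ℕ → Set (EuclideanSpace ℝ (Fin (k + 1))) := disjointed fun n => S ∩ U (a n)
  have ha : ∀ n, a n ∈ S := fun n => htS ⟨n, rfl⟩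
  have hVS : ⋃ n, V n = S := by
    rw [iUnion_disjointed, ← inter_iUnion]
    refine inter_eq_left.2 (hcover.trans ?_)
    rw [biUnion_range]
  have hV : ∀ n, MeasurableSet (V n) := fun n =>
    MeasurableSet.disjointed (fun n => hSU _ (ha n)) n
  have hVsub : ∀ n, V n ⊆ S ∩ U (a n) := fun n => disjointed_subset _ n
  have hdisj : Pairwise (Function.onFun Disjoint V) := disjoint_disjointed _
  calc μHE[j + 1] (B ∩ S) = μHE[j + 1] (⋃ n, B ∩ V n) := by rw [← inter_iUnion, hVS]
    _ ≤ ∑' n, μHE[j + 1] (B ∩ V n) := measure_iUnion_le _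
    _ ≤ ∑' n, (K : ℝ≥0∞) ^ (2 * (j + 1)) * sliceIntegral (j + 1) ((B ∩ V n).indicator 1) :=
        ENNReal.tsum_le_tsum fun n => hle _ (ha n) _ (inter_subset_right.trans (hVsub n))
          (hB.inter (hV n))
    _ ≤ (K : ℝ≥0∞) ^ (2 * (j + 1)) *
          sliceIntegral (j + 1) (fun p => ∑' n, (B ∩ V n).indicator 1 p) := by
        rw [ENNReal.tsum_mul_left]
        gcongr
        exact tsum_sliceIntegral_le _
    _ = _ := by
        congr 2
        funext p
        by_cases hp : p ∈ B ∩ S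
        · obtain ⟨i, hi⟩ := mem_iUnion.1 (hVS.symm ▸ hp.2)
          rw [tsum_eq_single i fun n hn => indicator_of_notMem
            (fun h => disjoint_left.1 (hdisj hn) h.2 hi) _]
          rw [indicator_of_mem hp, indicator_of_mem]
          exact ⟨hp.1, hi⟩
        · have h : ∀ n, p ∉ B ∩ V n := fun n h => hp ⟨h.1, (hVsub n h.2).1⟩
          simp only [indicator_of_notMem hp, indicator_of_notMem (h _), tsum_zero]

theorem IsSubmanifold.lintegral_le_mul_sliceIntegral {k j : ℕ}
    {S : Set (EuclideanSpace ℝ (Fin (k + 1)))} (hS : IsSubmanifold (j + 1) S) {K : NNReal}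
    (hK : 1 < K) {u : EuclideanSpace ℝ (Fin (k + 1)) → ℝ≥0∞} (hu : Measurable u) :
    ∫⁻ p in S, u p ∂μHE[j + 1] ≤
      (K : ℝ≥0∞) ^ (2 * (j + 1)) * sliceIntegral (j + 1) (S.indicator u) := by
  refine Measurable.ennreal_induction (motive := fun u => ∫⁻ p in S, u p ∂μHE[j + 1] ≤
    (K : ℝ≥0∞) ^ (2 * (j + 1)) * sliceIntegral (j + 1) (S.indicator u)) ?_ ?_ ?_ hu
  · intro c B hB
    rw [lintegral_indicator_const hB, Measure.restrict_apply hB]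
    calc c * μHE[j + 1] (B ∩ S) ≤ c * ((K : ℝ≥0∞) ^ (2 * (j + 1)) *
          sliceIntegral (j + 1) ((B ∩ S).indicator 1)) := by
          gcongr
          exact hS.euclideanHausdorffMeasure_inter_le hK hB
      _ = (K : ℝ≥0∞) ^ (2 * (j + 1)) *
          (c * sliceIntegral (j + 1) ((B ∩ S).indicator 1)) := by ring
      _ ≤ (K : ℝ≥0∞) ^ (2 * (j + 1)) *
          sliceIntegral (j + 1) (fun p => c * (B ∩ S).indicator 1 p) := by
          gcongr
          exact mul_sliceIntegral_le _ _
      _ = _ := by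
          congr 2
          funext p
          by_cases h1 : p ∈ B <;> by_cases h2 : p ∈ S <;> simp [h1, h2]
  · intro f g _ hf hg hf' hg'
    rw [indicator_add']
    calc _ = ∫⁻ p in S, f p ∂μHE[j + 1] + ∫⁻ p in S, g p ∂μHE[j + 1] := lintegral_add_left hf _
      _ ≤ _ := add_le_add hf' hg'
      _ ≤ _ := by
        rw [← mul_add]
        gcongr
        exact sliceIntegral_add_le _ _
  · intro f hf hmono ih
    rw [lintegral_iSup hf hmono]
    refine iSup_le fun n => (ih n).trans ?_
    gcongr
    refine sliceIntegral_mono fun p => indicator_le_indicator ?_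
    exact le_iSup (fun n => f n p) n

/-- The slicing inequality for an arbitrary measurable weight, obtained by letting the distortion
factor tend to `1`. -/
theorem IsSubmanifold.lintegral_le_sliceIntegral {k j : ℕ}
    {S : Set (EuclideanSpace ℝ (Fin (k + 1)))} (hS : IsSubmanifold (j + 1) S)
    {u : EuclideanSpace ℝ (Fin (k + 1)) → ℝ≥0∞} (hu : Measurable u) :
    ∫⁻ p in S, u p ∂μHE[j + 1] ≤ sliceIntegral (j + 1) (S.indicator u) := by
  have hlim : Filter.Tendsto (fun K : NNReal => (K : ℝ≥0∞) ^ (2 * (j + 1)) *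
      sliceIntegral (j + 1) (S.indicator u)) (nhdsWithin 1 (Ioi 1))
      (nhds (sliceIntegral (j + 1) (S.indicator u))) := by
    have h1 : Filter.Tendsto (fun K : NNReal => (K : ℝ≥0∞) ^ (2 * (j + 1)))
        (nhdsWithin 1 (Ioi 1)) (nhds (1 ^ (2 * (j + 1)))) :=
      ((ENNReal.continuous_pow _).comp ENNReal.continuous_coe).continuousWithinAt
    rw [one_pow] at h1
    simpa using ENNReal.Tendsto.mul_const h1 (Or.inl one_ne_zero)
  refine ge_of_tendsto hlim ?_
  filter_upwards [self_mem_nhdsWithin] with K hK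
  exact hS.lintegral_le_mul_sliceIntegral hK hu

/-- The slicing inequality for a product weight `f x * g y`. -/
theorem IsSubmanifold.lintegral_mul_le {k m : ℕ} (hm : 1 ≤ m)
    {S : Set (EuclideanSpace ℝ (Fin (k + 1)))} (hS : IsSubmanifold m S)
    {f : EuclideanSpace ℝ (Fin k) → ℝ} {g : ℝ → ℝ} (hf : Continuous f) (hg : Continuous g)
    (hf0 : ∀ x, 0 ≤ f x) :
    ∫⁻ p in S, ENNReal.ofReal (f (proj p) * g (height p)) ∂μHE[m] ≤
      (∫⁻ x in proj '' S,
        (∑' y : vertSlice S x, ENNReal.ofReal (g y)) * ENNReal.ofReal (f x) ∂μHE[m]) +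
      ∫⁻ y : ℝ, (∫⁻ x in horSlice S y, ENNReal.ofReal (f x) ∂μHE[m - 1]) *
        ENNReal.ofReal (g y) := by
  obtain ⟨j, rfl⟩ := Nat.exists_eq_add_of_le' hm
  refine (hS.lintegral_le_sliceIntegral (by fun_prop)).trans (add_le_add ?_ ?_)
  · refine le_trans (lintegral_mono fun x => ?_) (lintegral_indicator_le _ _)
    have h1 : ∀ y, S.indicator (fun p => ENNReal.ofReal (f (proj p) * g (height p))) (pair x y) =
        (vertSlice S x).indicator (fun y => ENNReal.ofReal (g y)) y * ENNReal.ofReal (f x) := by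
      intro y
      by_cases h : pair x y ∈ S
      · have h' : y ∈ vertSlice S x := h
        simp [h, h', ENNReal.ofReal_mul (hf0 x), mul_comm]
      · have h' : y ∉ vertSlice S x := h
        simp [h, h']
    simp only [h1]
    rw [ENNReal.tsum_mul_right, ← tsum_subtype]
    by_cases hx : x ∈ proj '' S
    · rw [indicator_of_mem hx]
    · have : IsEmpty (vertSlice S x) :=
        ⟨fun y => hx ⟨pair x y, y.2, proj_pair _ _⟩⟩
      simp
  · refine lintegral_mono fun y => ?_
    rw [← lintegral_mul_const' _ _ ENNReal.ofReal_ne_top]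
    refine le_trans (lintegral_mono fun x => ?_) (lintegral_indicator_le _ _)
    by_cases h : pair x y ∈ S
    · have h' : x ∈ horSlice S y := h
      simp [h, h', ENNReal.ofReal_mul (hf0 x)]
    · simp [h]

/-! ### Gaussian weights -/

@[fun_prop]
theorem continuous_gaussWeight {E : Type*} [NormedAddCommGroup E] (m : ℕ) :
    Continuous (gaussWeight m : E → ℝ) := by
  unfold gaussWeight; fun_prop

theorem gaussWeight_nonneg {E : Type*} [Norm E] (m : ℕ) (x : E) : 0 ≤ gaussWeight m x := by
  unfold gaussWeight; positivity

theorem gaussWeight_eq_mul_exp {k : ℕ} (m : ℕ) (p : EuclideanSpace ℝ (Fin (k + 1))) :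
    gaussWeight m p = gaussWeight m (proj p) * Real.exp (-(height p) ^ 2 / 4) := by
  rw [gaussWeight, gaussWeight, norm_sq_eq_proj_height, mul_assoc, ← Real.exp_add]
  congr 2
  ring

theorem gaussWeight_mul_exp {E : Type*} [Norm E] {m : ℕ} (hm : 1 ≤ m) (x : E) (y : ℝ) :
    gaussWeight m x * Real.exp (-y ^ 2 / 4) = gaussWeight (m - 1) x * gaussWeight 1 y := by
  have h : (4 * Real.pi) ^ (-(m : ℝ) / 2) =
      (4 * Real.pi) ^ (-((m - 1 : ℕ) : ℝ) / 2) * (4 * Real.pi) ^ (-((1 : ℕ) : ℝ) / 2) := by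
    rw [← Real.rpow_add (by positivity)]
    congr 1
    push_cast [hm]
    ring
  simp only [gaussWeight]
  rw [h, Real.norm_eq_abs, sq_abs]
  ring

/-- The weight `Φ_m (x, y)` is the product of `f x = Φ_m x` and `g y = exp (-y² / 4) ≤ 1`, so the
fiber sums are at most the multiplicities; in the second term, the normalizing factor
`(4π)^(-1/2)` is moved from `Φ_m x` to `g y`. -/
theorem IsSubmanifold.gaussArea_le {k m : ℕ} (hm : 1 ≤ m)
    {S : Set (EuclideanSpace ℝ (Fin (k + 1)))} (hS : IsSubmanifold m S) :
    gaussArea m S ≤ gaussAreaProj m S +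
      ∫⁻ y : ℝ, gaussArea (m - 1) (horSlice S y) * ENNReal.ofReal (gaussWeight 1 y) := by
  have h := hS.lintegral_mul_le hm (f := gaussWeight m) (g := fun y => Real.exp (-y ^ 2 / 4))
    (by fun_prop) (by fun_prop) (gaussWeight_nonneg m)
  simp only [← gaussWeight_eq_mul_exp] at h
  refine h.trans (add_le_add (lintegral_mono fun x => ?_) (lintegral_mono fun y => ?_))
  · dsimp only
    gcongr
    rw [← ENNReal.tsum_set_one]
    refine ENNReal.tsum_le_tsum fun y => ?_
    rw [ENNReal.ofReal_le_one, Real.exp_le_one_iff]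
    nlinarith [sq_nonneg (y : ℝ)]
  · dsimp only
    rw [gaussArea, ← lintegral_mul_const' _ _ ENNReal.ofReal_ne_top,
      ← lintegral_mul_const' _ _ ENNReal.ofReal_ne_top]
    refine lintegral_mono fun x => ?_
    dsimp only
    rw [← ENNReal.ofReal_mul (gaussWeight_nonneg _ _), ← ENNReal.ofReal_mul
      (gaussWeight_nonneg _ _), gaussWeight_mul_exp hm]

end GaussSlicing

theorem mainTheorem7 (k m : ℕ) (hm : 1 ≤ m) (S : Set (EuclideanSpace ℝ (Fin (k + 1))))
    (hS : GaussSlicing.IsSubmanifold m S) :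
    (∀ (f : EuclideanSpace ℝ (Fin k) → ℝ) (g : ℝ → ℝ), ContDiff ℝ ∞ f → ContDiff ℝ ∞ g →
      (∀ x, 0 ≤ f x) → (∀ y, 0 ≤ g y) →
      ∫⁻ p in S, ENNReal.ofReal (f (GaussSlicing.proj p) * g (GaussSlicing.height p)) ∂μHE[m] ≤
        (∫⁻ x in GaussSlicing.proj '' S,
          (∑' y : GaussSlicing.vertSlice S x, ENNReal.ofReal (g y)) * ENNReal.ofReal (f x) ∂μHE[m])
        + ∫⁻ y : ℝ, (∫⁻ x in GaussSlicing.horSlice S y, ENNReal.ofReal (f x) ∂μHE[m - 1]) *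
            ENNReal.ofReal (g y)) ∧
    GaussSlicing.gaussArea m S ≤
      GaussSlicing.gaussAreaProj m S +
        ∫⁻ y : ℝ, GaussSlicing.gaussArea (m - 1) (GaussSlicing.horSlice S y) *
          ENNReal.ofReal (GaussSlicing.gaussWeight 1 y) :=
  ⟨fun _ _ hf hg hf0 _ => hS.lintegral_mul_le hm hf.continuous hg.continuous hf0,
    hS.gaussArea_le hm⟩
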